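/- A mechanism for selling $k$ items to a single additive buyer with valuation $x\in\mathbb{R}_+^k$ is a pair of measurable functions $q:\mathbb{R}_+^k\to[0,1]^k$ (allocation probabilities) and $s:\mathbb{R}_+^k\to\mathbb{R}$ (payment). It is incentive compatible if $x\cdot q(x)-s(x)\ge x\cdot q(x')-s(x')$ for all $x,x'\in\mathbb{R}_+^k$, and individually rational if $x\cdot q(x)-s(x)\ge 0$ for all $x\in\mathbb{R}_+^k$. For a probability distribution $\mathcal{F}$ on $\mathbb{R}_+^k$, let $\mathrm{Rev}_k(\mathcal{F})\in[0,\infty]$ be the supremum of $\mathbb{E}_{x\sim\mathcal{F}}[s(x)]$ over all incentive compatible and individually rational mechanisms $(q,s)$ for $k$ items. There exists a constant $c>0$ such that for every integer $k\ge 2$ and all probability distributions $F_1,\dots,F_k$ on $\mathbb{R}_+$, $$\mathrm{Rev}_1(F_1)+\cdots+\mathrm{Rev}_1(F_k)\;\ge\;\frac{c}{\log^2 k}\cdot\mathrm{Rev}_k(F_1\times\cdots\times F_k),$$ where $F_1\times\cdots\times F_k$ is the product distribution and $\log$ is the natural logarithm. -/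

import Mathlib

open MeasureTheory
open scoped NNReal ENNReal

/-- A direct mechanism for selling the items of a finite set `ι` to a single buyer. A valuation is
a vector `x : ι → ℝ≥0`; at the reported valuation `x` item `i` is allocated with probability
`q x i`, and the buyer makes the expected payment `s x` (a real number of either sign).
Measurability makes the expected payment meaningful. -/
structure Mechanism (ι : Type*) where
  q : (ι → ℝ≥0) → ι → ℝ
  s : (ι → ℝ≥0) → ℝ
  q_nonneg : ∀ x i, 0 ≤ q x i
  q_le_one : ∀ x i, q x i ≤ 1
  measurable_q : Measurable q
  measurable_s : Measurable s

namespace Mechanism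

variable {ι : Type*} [Fintype ι]

/-- Utility of a buyer with true valuation `x` who reports `y`. -/
def utility (M : Mechanism ι) (x y : ι → ℝ≥0) : ℝ :=
  ∑ i, (x i : ℝ) * M.q y i - M.s y

/-- Ex-post individual rationality. -/
def IsIR (M : Mechanism ι) : Prop :=
  ∀ x, 0 ≤ M.utility x x

/-- Incentive compatibility. -/
def IsIC (M : Mechanism ι) : Prop :=
  ∀ x y, M.utility x y ≤ M.utility x x

/-- Expected payment when the valuation has law `μ`, as an extended real: the expectation of the
positive part minus the expectation of the negative part. For an incentive compatible mechanism
`s` is bounded below by `s 0`, so for a probability measure the second term is finite. -/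
noncomputable def revenue (M : Mechanism ι) (μ : Measure (ι → ℝ≥0)) : EReal :=
  ((∫⁻ x, ENNReal.ofReal (M.s x) ∂μ : ℝ≥0∞) : EReal) -
    ((∫⁻ x, ENNReal.ofReal (-M.s x) ∂μ : ℝ≥0∞) : EReal)

end Mechanism

/-- The optimal revenue from a buyer with valuation of law `μ`: the supremum of the expected
payment over all incentive compatible and individually rational mechanisms. -/
noncomputable def Rev {ι : Type*} [Fintype ι] (μ : Measure (ι → ℝ≥0)) : EReal :=
  ⨆ (M : Mechanism ι) (_ : M.IsIC) (_ : M.IsIR), M.revenue μ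

/-- The optimal revenue from a single item whose value has law `F`. -/
noncomputable def Rev₁ (F : Measure ℝ≥0) : EReal :=
  Rev (F.map (fun (x : ℝ≥0) (_ : Fin 1) => x))

/-!
Write `Rᵢ = Rev₁ (F i)` and `R = ∑ i, Rᵢ`. In an incentive compatible and individually rational
mechanism, fix the reports for all items but `i` and return to the buyer the value of the other
items he receives: what is left sells item `i` alone, so it earns at most `Rᵢ`. Using this at each
valuation with `i` a most valuable item, the revenue is at most `R` plus the expected total value
of the items that some other item matches. Posting the price `t` gives `t * F i [t, ∞) ≤ Rᵢ`, so by
independence an item of value `t` is matched with probability at most `min (1, R / t)`, and item `j`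
contributes at most `E[min (xⱼ, R)]`. Integrating the tail bound `Rⱼ / t` between `R / k` and `R`,
and `1` below `R / k`, shows that these expectations sum to at most `R * (1 + log k)`. Hence
`Rev ≤ (2 + log k) * R`, which for `k ≥ 2` is at most a constant times `log² k * R`.
-/

section TruncatedMoments

theorem setLIntegral_Ioc_ofReal_inv {a b : ℝ} (ha : 0 < a) (hab : a ≤ b) :
    ∫⁻ t in Set.Ioc a b, ENNReal.ofReal t⁻¹ = ENNReal.ofReal (Real.log (b / a)) := by
  have hint : IntervalIntegrable (fun t : ℝ => t⁻¹) volume a b :=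
    intervalIntegral.intervalIntegrable_inv
      (fun t ht => (ha.trans_le (Set.uIcc_of_le hab ▸ ht).1).ne') continuousOn_id
  have hnonneg : 0 ≤ᵐ[volume.restrict (Set.Ioc a b)] fun t : ℝ => t⁻¹ := by
    filter_upwards [ae_restrict_mem measurableSet_Ioc] with t ht
    exact inv_nonneg.mpr (ha.trans ht.1).le
  rw [← ofReal_integral_eq_lintegral_ofReal hint.1 hnonneg, ← intervalIntegral.integral_of_le hab,
    integral_inv_of_pos ha (ha.trans_le hab)]

theorem measure_le_mul_ofReal_inv {Ω : Type*} [MeasurableSpace Ω] {μ : Measure Ω} {X : Ω → ℝ≥0}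
    {r : ℝ≥0∞} (hr : ∀ t : ℝ≥0, t * μ {ω | t ≤ X ω} ≤ r) {t : ℝ} (ht : 0 < t) :
    μ {ω | t ≤ X ω} ≤ r * ENNReal.ofReal t⁻¹ := by
  lift t to ℝ≥0 using ht.le
  have ht' : (t : ℝ≥0∞) ≠ 0 := by exact_mod_cast ht.ne'
  rw [ENNReal.ofReal_inv_of_pos ht, ENNReal.ofReal_coe_nnreal, ← div_eq_mul_inv,
    ENNReal.le_div_iff_mul_le (.inl ht') (.inl ENNReal.coe_ne_top), mul_comm]
  exact hr t

theorem lintegral_min_le_add_mul_log {Ω : Type*} [MeasurableSpace Ω] {μ : Measure Ω}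
    [IsProbabilityMeasure μ] {X : Ω → ℝ≥0} (hX : Measurable X) {r : ℝ≥0∞}
    (hr : ∀ t : ℝ≥0, t * μ {ω | t ≤ X ω} ≤ r) {a b : ℝ≥0} (ha : 0 < a) (hab : a ≤ b) :
    ∫⁻ ω, min (X ω : ℝ≥0∞) b ∂μ ≤ a + r * ENNReal.ofReal (Real.log (b / a)) := by
  have htail : ∀ t ∈ Set.Ioi (0 : ℝ), μ {ω | t ≤ (min (X ω) b : ℝ≥0)} ≤
      (Set.Ioc (0 : ℝ) a).indicator 1 t +
        (Set.Ioc (a : ℝ) b).indicator (fun t => r * ENNReal.ofReal t⁻¹) t := by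
    intro t (ht : 0 < t)
    rcases le_or_gt t a with hta | hat
    · simpa [ht, hta] using prob_le_one (μ := μ)
    rcases le_or_gt t b with htb | hbt
    · simpa [hat, hat.not_ge, htb] using measure_le_mul_ofReal_inv hr ht
    · simp [hbt.not_ge]
  calc ∫⁻ ω, min (X ω : ℝ≥0∞) b ∂μ
      = ∫⁻ ω, ENNReal.ofReal (min (X ω) b : ℝ≥0) ∂μ := by
        simp only [ENNReal.ofReal_coe_nnreal, ENNReal.coe_min]
    _ = ∫⁻ t in Set.Ioi (0 : ℝ), μ {ω | t ≤ (min (X ω) b : ℝ≥0)} :=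
        lintegral_eq_lintegral_meas_le μ (.of_forall fun _ => NNReal.coe_nonneg _) (by fun_prop)
    _ ≤ ∫⁻ t, (Set.Ioc (0 : ℝ) a).indicator 1 t +
          (Set.Ioc (a : ℝ) b).indicator (fun t => r * ENNReal.ofReal t⁻¹) t :=
        (setLIntegral_mono' measurableSet_Ioi htail).trans (setLIntegral_le_lintegral _ _)
    _ = a + r * ENNReal.ofReal (Real.log (b / a)) := by
        rw [lintegral_add_left (measurable_one.indicator measurableSet_Ioc),
          lintegral_indicator_one measurableSet_Ioc, lintegral_indicator measurableSet_Ioc,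
          lintegral_const_mul _ (by fun_prop),
          setLIntegral_Ioc_ofReal_inv (NNReal.coe_pos.mpr ha) (NNReal.coe_le_coe.mpr hab),
          Real.volume_Ioc, sub_zero, ENNReal.ofReal_coe_nnreal]

theorem sum_lintegral_min_sum_le {ι : Type*} [Fintype ι] [Nonempty ι] {F : ι → Measure ℝ≥0}
    [∀ i, IsProbabilityMeasure (F i)] {r : ι → ℝ≥0∞}
    (hr : ∀ i, ∀ t : ℝ≥0, t * F i (Set.Ici t) ≤ r i) :
    ∑ i, ∫⁻ t, min (t : ℝ≥0∞) (∑ j, r j) ∂F i ≤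
      (1 + ENNReal.ofReal (Real.log (Fintype.card ι))) * ∑ i, r i := by
  rcases eq_or_ne (∑ i, r i) ⊤ with htop | hfin
  · simp [htop, ENNReal.mul_top]
  lift ∑ i, r i to ℝ≥0 using hfin with R hR
  rcases eq_zero_or_pos R with rfl | hRpos
  · simp
  have hcard : (1 : ℝ≥0) ≤ Fintype.card ι := by exact_mod_cast Fintype.card_pos (α := ι)
  have hcard_pos : (0 : ℝ≥0) < Fintype.card ι := one_pos.trans_le hcard
  have hmoment : ∀ i, ∫⁻ t, min (t : ℝ≥0∞) R ∂F i ≤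
      (R / Fintype.card ι : ℝ≥0) + r i * ENNReal.ofReal (Real.log (Fintype.card ι)) := fun i => by
    have hratio : (R : ℝ) / (R / Fintype.card ι : ℝ≥0) = Fintype.card ι := by
      push_cast
      field_simp
    have h := lintegral_min_le_add_mul_log measurable_id (hr i)
      (div_pos hRpos hcard_pos) (div_le_self zero_le hcard)
    rwa [hratio] at h
  calc ∑ i, ∫⁻ t, min (t : ℝ≥0∞) R ∂F i
      ≤ ∑ i, ((R / Fintype.card ι : ℝ≥0) + r i * ENNReal.ofReal (Real.log (Fintype.card ι))) :=
        Finset.sum_le_sum fun i _ => hmoment i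
    _ = R + R * ENNReal.ofReal (Real.log (Fintype.card ι)) := by
        rw [Finset.sum_add_distrib, ← Finset.sum_mul, ← hR, Finset.sum_const, Finset.card_univ,
          nsmul_eq_mul, ← ENNReal.coe_natCast, ← ENNReal.coe_mul, mul_div_cancel₀ _ hcard_pos.ne']
    _ = (1 + ENNReal.ofReal (Real.log (Fintype.card ι))) * R := by ring

end TruncatedMoments

theorem lintegral_pi_update {ι : Type*} [Fintype ι] [DecidableEq ι] {α : ι → Type*}
    [∀ i, MeasurableSpace (α i)] (μ : ∀ i, Measure (α i)) [∀ i, SigmaFinite (μ i)] (i : ι)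
    [IsProbabilityMeasure (μ i)] {f : (∀ i, α i) → ℝ≥0∞} (hf : Measurable f) :
    ∫⁻ x, ∫⁻ t, f (Function.update x i t) ∂μ i ∂Measure.pi μ = ∫⁻ x, f x ∂Measure.pi μ := by
  simp only [← lmarginal_singleton]
  refine lintegral_eq_of_lmarginal_eq {i} (hf.lmarginal μ) hf ?_
  ext x
  simp [lmarginal_singleton (μ := μ) (∫⋯∫⁻_{i}, f ∂μ), lmarginal_update_of_mem]

section Matched

variable {ι : Type*}

/-- The valuations at which item `j` is not the unique most valuable item: the ones whose `x j` is
left over when the payment is charged to a most valuable item. -/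
def matchedSet (j : ι) : Set (ι → ℝ≥0) :=
  {x | ∃ i, i ≠ j ∧ x j ≤ x i}

theorem measurableSet_matchedSet [Countable ι] (j : ι) : MeasurableSet (matchedSet j) := by
  unfold matchedSet
  measurability

variable [Fintype ι]

theorem mul_measure_pi_exists_le (F : ι → Measure ℝ≥0) [∀ i, IsProbabilityMeasure (F i)]
    {r : ι → ℝ≥0∞} (hr : ∀ i, ∀ t : ℝ≥0, t * F i (Set.Ici t) ≤ r i) (t : ℝ≥0) :
    t * Measure.pi F {x | ∃ i, t ≤ x i} ≤ min (t : ℝ≥0∞) (∑ i, r i) := by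
  refine le_min (mul_le_of_le_one_right' prob_le_one) ?_
  calc t * Measure.pi F {x | ∃ i, t ≤ x i}
      ≤ t * ∑ i, Measure.pi F {x | t ≤ x i} := by
        rw [Set.ofPred_exists]
        gcongr
        exact measure_iUnion_fintype_le _ _
    _ = ∑ i, t * F i (Set.Ici t) := by
        rw [Finset.mul_sum]
        refine Finset.sum_congr rfl fun i _ => congrArg _ ?_
        exact (measurePreserving_eval F i).measure_preimage measurableSet_Ici.nullMeasurableSet
    _ ≤ ∑ i, r i := Finset.sum_le_sum fun i _ => hr i t

theorem setLIntegral_matchedSet_le (F : ι → Measure ℝ≥0) [∀ i, IsProbabilityMeasure (F i)]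
    {r : ι → ℝ≥0∞} (hr : ∀ i, ∀ t : ℝ≥0, t * F i (Set.Ici t) ≤ r i) (j : ι) :
    ∫⁻ x in matchedSet j, x j ∂Measure.pi F ≤ ∫⁻ t, min (t : ℝ≥0∞) (∑ i, r i) ∂F j := by
  classical
  set f : (ι → ℝ≥0) → ℝ≥0∞ := (matchedSet j).indicator fun x => (x j : ℝ≥0∞) with hf_def
  have hf : Measurable f := Measurable.indicator (by fun_prop) (measurableSet_matchedSet j)
  have hle : ∀ (t : ℝ≥0) (x : ι → ℝ≥0),
      f (Function.update x j t) ≤ {x | ∃ i, t ≤ x i}.indicator (fun _ => (t : ℝ≥0∞)) x := by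
    intro t x
    by_cases hx : Function.update x j t ∈ matchedSet j
    · have ⟨i, hij, hi⟩ := hx
      rw [Function.update_self, Function.update_of_ne hij] at hi
      simp only [hf_def, Set.indicator_of_mem hx, Function.update_self]
      rw [Set.indicator_of_mem (show x ∈ {x : ι → ℝ≥0 | ∃ i, t ≤ x i} from ⟨i, hi⟩)]
    · simp [hf_def, Set.indicator_of_notMem hx]
  calc ∫⁻ x in matchedSet j, x j ∂Measure.pi F
      = ∫⁻ x, ∫⁻ t, f (Function.update x j t) ∂F j ∂Measure.pi F := by
        rw [lintegral_pi_update F j hf, lintegral_indicator (measurableSet_matchedSet j)]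
    _ = ∫⁻ t, ∫⁻ x, f (Function.update x j t) ∂Measure.pi F ∂F j :=
        lintegral_lintegral_swap (hf.comp measurable_update').aemeasurable
    _ ≤ ∫⁻ t, min (t : ℝ≥0∞) (∑ i, r i) ∂F j := by
        refine lintegral_mono fun t => (lintegral_mono (hle t)).trans ?_
        exact (lintegral_indicator_const_le _ _).trans (mul_measure_pi_exists_le F hr t)

end Matched

namespace Mechanism

section Revenue

variable {ι : Type*} {M : Mechanism ι}

theorem revenue_le_lintegral (M : Mechanism ι) (μ : Measure (ι → ℝ≥0)) :
    M.revenue μ ≤ ((∫⁻ x, ENNReal.ofReal (M.s x) ∂μ : ℝ≥0∞) : EReal) := by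
  simpa [revenue] using EReal.sub_le_sub le_rfl (EReal.coe_ennreal_nonneg _)

theorem revenue_eq_lintegral (hs : ∀ x, 0 ≤ M.s x) (μ : Measure (ι → ℝ≥0)) :
    M.revenue μ = ((∫⁻ x, ENNReal.ofReal (M.s x) ∂μ : ℝ≥0∞) : EReal) := by
  simp [revenue, ENNReal.ofReal_of_nonpos, hs]

variable [Fintype ι]

theorem IsIC.payment_zero_le (hIC : M.IsIC) (x : ι → ℝ≥0) : M.s 0 ≤ M.s x := by
  simpa [utility] using hIC 0 x

theorem revenue_le_Rev (hIC : M.IsIC) (hIR : M.IsIR) (μ : Measure (ι → ℝ≥0)) :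
    M.revenue μ ≤ Rev μ :=
  le_iSup₂_of_le M hIC (le_iSup_of_le hIR le_rfl)

end Revenue

theorem lintegral_payment_le_Rev₁ {M : Mechanism (Fin 1)} (hIC : M.IsIC) (hIR : M.IsIR)
    (h0 : 0 ≤ M.s 0) (F : Measure ℝ≥0) :
    ((∫⁻ t, ENNReal.ofReal (M.s fun _ => t) ∂F : ℝ≥0∞) : EReal) ≤ Rev₁ F := by
  have h := revenue_le_Rev hIC hIR (F.map fun t _ => t)
  rwa [revenue_eq_lintegral fun x => h0.trans (hIC.payment_zero_le x),
    lintegral_map M.measurable_s.ennreal_ofReal (by fun_prop)] at h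

section PostedPrice

/-- The single-item mechanism that offers the item at the take-it-or-leave-it price `p`; a buyer
of value exactly `p` buys. -/
noncomputable def postedPrice (p : ℝ≥0) : Mechanism (Fin 1) where
  q x _ := if p ≤ x 0 then 1 else 0
  s x := if p ≤ x 0 then p else 0
  q_nonneg _ _ := by split_ifs <;> simp
  q_le_one _ _ := by split_ifs <;> simp
  measurable_q := measurable_pi_lambda _ fun _ =>
    .ite (measurableSet_le measurable_const (measurable_pi_apply 0)) measurable_const
      measurable_const
  measurable_s :=
    .ite (measurableSet_le measurable_const (measurable_pi_apply 0)) measurable_const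
      measurable_const

theorem utility_postedPrice (p : ℝ≥0) (x y : Fin 1 → ℝ≥0) :
    (postedPrice p).utility x y = if p ≤ y 0 then (x 0 : ℝ) - p else 0 := by
  simp only [utility, postedPrice, Fin.sum_univ_one]
  split_ifs <;> simp

theorem isIR_postedPrice (p : ℝ≥0) : (postedPrice p).IsIR := fun x => by
  rw [utility_postedPrice]
  split_ifs with h
  · exact sub_nonneg.mpr (NNReal.coe_le_coe.mpr h)
  · exact le_rfl

theorem isIC_postedPrice (p : ℝ≥0) : (postedPrice p).IsIC := fun x y => by
  rcases le_or_gt p (x 0) with h | h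
  · have : (p : ℝ) ≤ x 0 := h
    simp only [utility_postedPrice, if_pos h]
    split_ifs <;> linarith
  · have : (x 0 : ℝ) < p := h
    simp only [utility_postedPrice, if_neg h.not_ge]
    split_ifs <;> linarith

theorem mul_measure_Ici_le_Rev₁ (p : ℝ≥0) (F : Measure ℝ≥0) :
    ((p * F (Set.Ici p) : ℝ≥0∞) : EReal) ≤ Rev₁ F := by
  have hs : ∀ t : ℝ≥0, ENNReal.ofReal ((postedPrice p).s fun _ => t) =
      (Set.Ici p).indicator (fun _ => (p : ℝ≥0∞)) t := fun t => by
    by_cases h : p ≤ t <;> simp [postedPrice, h]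
  have h := lintegral_payment_le_Rev₁ (isIC_postedPrice p) (isIR_postedPrice p)
    (by simp only [postedPrice]; positivity) F
  rwa [lintegral_congr hs, lintegral_indicator_const measurableSet_Ici] at h

end PostedPrice

end Mechanism

theorem Rev₁_nonneg (F : Measure ℝ≥0) : 0 ≤ Rev₁ F :=
  (EReal.coe_ennreal_nonneg _).trans (Mechanism.mul_measure_Ici_le_Rev₁ 0 F)

theorem mul_measure_Ici_le_toENNReal_Rev₁ (F : Measure ℝ≥0) (t : ℝ≥0) :
    t * F (Set.Ici t) ≤ (Rev₁ F).toENNReal := by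
  rw [← EReal.toENNReal_coe (x := t * F (Set.Ici t))]
  exact EReal.toENNReal_le_toENNReal (Mechanism.mul_measure_Ici_le_Rev₁ t F)

namespace Mechanism

section Slice

variable {ι : Type*} [Fintype ι] [DecidableEq ι] {M : Mechanism ι}

/-- The payment for item `i` when the buyer is returned the value of the other items he receives,
shifted by a term independent of `x i` so that it vanishes at `x i = 0`. As `M.utility x x` is the
value of all items received minus `M.s x`, the returned value need not be written out. -/
noncomputable def slicePayment (M : Mechanism ι) (i : ι) (x : ι → ℝ≥0) : ℝ :=
  x i * M.q x i - M.utility x x + M.utility (Function.update x i 0) (Function.update x i 0)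

theorem measurable_slicePayment (M : Mechanism ι) (i : ι) : Measurable (M.slicePayment i) := by
  have hs := M.measurable_s
  have hq : ∀ j, Measurable fun x => M.q x j := fun j =>
    (measurable_pi_apply j).comp M.measurable_q
  have hu : Measurable fun x => M.utility x x := by
    unfold utility
    fun_prop
  have h0 : Measurable fun x : ι → ℝ≥0 => Function.update x i 0 := measurable_update_left
  unfold slicePayment
  exact (by fun_prop : Measurable fun x => (x i : ℝ) * M.q x i - M.utility x x).add (hu.comp h0)

/-- The single-item mechanism for item `i` obtained from `M` by fixing the reports for the other
items to those of `x` and charging `M.slicePayment`. -/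
noncomputable def slice (M : Mechanism ι) (i : ι) (x : ι → ℝ≥0) : Mechanism (Fin 1) where
  q y _ := M.q (Function.update x i (y 0)) i
  s y := M.slicePayment i (Function.update x i (y 0))
  q_nonneg _ _ := M.q_nonneg _ _
  q_le_one _ _ := M.q_le_one _ _
  measurable_q := measurable_pi_lambda _ fun _ => (measurable_pi_apply i).comp <|
    M.measurable_q.comp <| (measurable_update x).comp (measurable_pi_apply 0)
  measurable_s := (M.measurable_slicePayment i).comp <|
    (measurable_update x).comp (measurable_pi_apply 0)

theorem utility_update (M : Mechanism ι) (i : ι) (x y : ι → ℝ≥0) (t : ℝ≥0) :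
    M.utility (Function.update x i t) y = M.utility x y + (t - x i) * M.q y i := by
  have hrest : ∑ j ∈ Finset.univ.erase i, (Function.update x i t j : ℝ) * M.q y j =
      ∑ j ∈ Finset.univ.erase i, (x j : ℝ) * M.q y j :=
    Finset.sum_congr rfl fun j hj => by rw [Function.update_of_ne (Finset.ne_of_mem_erase hj)]
  simp only [utility, ← Finset.add_sum_erase _ _ (Finset.mem_univ i), hrest, Function.update_self]
  ring

theorem utility_slice (M : Mechanism ι) (i : ι) (x : ι → ℝ≥0) (y z : Fin 1 → ℝ≥0) :
    (M.slice i x).utility y z =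
      M.utility (Function.update x i (y 0)) (Function.update x i (z 0)) -
        M.utility (Function.update x i 0) (Function.update x i 0) := by
  have hslice : (M.slice i x).utility y z = y 0 * M.q (Function.update x i (z 0)) i -
      M.slicePayment i (Function.update x i (z 0)) := by
    simp [utility, slice]
  have hupdate := M.utility_update i (Function.update x i (z 0)) (Function.update x i (z 0)) (y 0)
  rw [Function.update_idem, Function.update_self] at hupdate
  rw [hslice, hupdate, slicePayment, Function.update_idem, Function.update_self]
  ring

theorem IsIC.slice (hIC : M.IsIC) (i : ι) (x : ι → ℝ≥0) : (M.slice i x).IsIC := fun y z => by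
  simpa only [utility_slice] using sub_le_sub_right (hIC _ _) _

theorem IsIC.isIR_slice (hIC : M.IsIC) (i : ι) (x : ι → ℝ≥0) : (M.slice i x).IsIR := fun y => by
  rw [utility_slice, sub_nonneg]
  calc M.utility (Function.update x i 0) (Function.update x i 0)
      ≤ M.utility (Function.update x i 0) (Function.update x i 0) +
          y 0 * M.q (Function.update x i 0) i :=
        le_add_of_nonneg_right (mul_nonneg (y 0).coe_nonneg (M.q_nonneg _ _))
    _ = M.utility (Function.update x i (y 0)) (Function.update x i 0) := by
        simpa using (M.utility_update i (Function.update x i 0) (Function.update x i 0) (y 0)).symm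
    _ ≤ M.utility (Function.update x i (y 0)) (Function.update x i (y 0)) := hIC _ _

theorem IsIC.lintegral_slicePayment_update_le (hIC : M.IsIC) (i : ι) (x : ι → ℝ≥0)
    (F : Measure ℝ≥0) :
    ∫⁻ t, ENNReal.ofReal (M.slicePayment i (Function.update x i t)) ∂F ≤ (Rev₁ F).toENNReal := by
  have h0 : 0 ≤ (M.slice i x).s 0 := by simp [Mechanism.slice, slicePayment]
  rw [← EReal.toENNReal_coe (x := ∫⁻ t, _ ∂F)]
  exact EReal.toENNReal_le_toENNReal
    (lintegral_payment_le_Rev₁ (hIC.slice i x) (hIC.isIR_slice i x) h0 F)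

theorem IsIC.lintegral_pi_slicePayment_le (hIC : M.IsIC) (F : ι → Measure ℝ≥0)
    [∀ i, IsProbabilityMeasure (F i)] (i : ι) :
    ∫⁻ x, ENNReal.ofReal (M.slicePayment i x) ∂Measure.pi F ≤ (Rev₁ (F i)).toENNReal := by
  rw [← lintegral_pi_update F i (M.measurable_slicePayment i).ennreal_ofReal]
  calc ∫⁻ x, ∫⁻ t, ENNReal.ofReal (M.slicePayment i (Function.update x i t)) ∂F i ∂Measure.pi F
      ≤ ∫⁻ _, (Rev₁ (F i)).toENNReal ∂Measure.pi F :=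
        lintegral_mono fun x => hIC.lintegral_slicePayment_update_le i x (F i)
    _ = (Rev₁ (F i)).toENNReal := by simp

theorem IsIR.payment_le_slicePayment_add_sum (hIR : M.IsIR) (i : ι) (x : ι → ℝ≥0) :
    M.s x ≤ M.slicePayment i x + ∑ j ∈ Finset.univ.erase i, (x j : ℝ) := by
  have hothers : ∑ j ∈ Finset.univ.erase i, (x j : ℝ) * M.q x j ≤
      ∑ j ∈ Finset.univ.erase i, (x j : ℝ) :=
    Finset.sum_le_sum fun j _ => mul_le_of_le_one_right (x j).coe_nonneg (M.q_le_one x j)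
  have hutility : M.utility x x =
      x i * M.q x i + ∑ j ∈ Finset.univ.erase i, (x j : ℝ) * M.q x j - M.s x := by
    rw [utility, Finset.add_sum_erase _ (fun j => (x j : ℝ) * M.q x j) (Finset.mem_univ i)]
  have hzero := hIR (Function.update x i 0)
  rw [slicePayment]
  linarith

end Slice

variable {ι : Type*} [Fintype ι] [Nonempty ι] {M : Mechanism ι}

theorem IsIR.ofReal_payment_le [DecidableEq ι] (hIR : M.IsIR) (x : ι → ℝ≥0) :
    ENNReal.ofReal (M.s x) ≤ ∑ i, ENNReal.ofReal (M.slicePayment i x) +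
      ∑ j, (matchedSet j).indicator (fun x => (x j : ℝ≥0∞)) x := by
  obtain ⟨m, hm⟩ := Finite.exists_max x
  have hmatched : ∀ j ∈ Finset.univ.erase m,
      (x j : ℝ≥0∞) = (matchedSet j).indicator (fun x => (x j : ℝ≥0∞)) x := fun j hj => by
    have hmem : x ∈ matchedSet j := ⟨m, (Finset.ne_of_mem_erase hj).symm, hm j⟩
    rw [Set.indicator_of_mem hmem]
  calc ENNReal.ofReal (M.s x)
      ≤ ENNReal.ofReal (M.slicePayment m x + ∑ j ∈ Finset.univ.erase m, (x j : ℝ)) :=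
        ENNReal.ofReal_le_ofReal (hIR.payment_le_slicePayment_add_sum m x)
    _ ≤ ENNReal.ofReal (M.slicePayment m x) + ∑ j ∈ Finset.univ.erase m, (x j : ℝ≥0∞) := by
        refine ENNReal.ofReal_add_le.trans_eq ?_
        rw [ENNReal.ofReal_sum_of_nonneg fun j _ => (x j).coe_nonneg]
        simp only [ENNReal.ofReal_coe_nnreal]
    _ ≤ ∑ i, ENNReal.ofReal (M.slicePayment i x) +
          ∑ j, (matchedSet j).indicator (fun x => (x j : ℝ≥0∞)) x := by
        rw [Finset.sum_congr rfl hmatched]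
        exact add_le_add
          (Finset.single_le_sum (f := fun i => ENNReal.ofReal (M.slicePayment i x))
            (fun _ _ => zero_le) (Finset.mem_univ m))
          (Finset.sum_le_sum_of_subset (Finset.erase_subset _ _))

theorem lintegral_payment_le (hIC : M.IsIC) (hIR : M.IsIR) (F : ι → Measure ℝ≥0)
    [∀ i, IsProbabilityMeasure (F i)] :
    ∫⁻ x, ENNReal.ofReal (M.s x) ∂Measure.pi F ≤
      ENNReal.ofReal (2 + Real.log (Fintype.card ι)) * ∑ i, (Rev₁ (F i)).toENNReal := by
  classical
  have hslice : ∀ i, Measurable fun x => ENNReal.ofReal (M.slicePayment i x) := fun i =>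
    (M.measurable_slicePayment i).ennreal_ofReal
  have hmatched : ∀ j, Measurable ((matchedSet j).indicator fun x : ι → ℝ≥0 => (x j : ℝ≥0∞)) :=
    fun j => Measurable.indicator (by fun_prop) (measurableSet_matchedSet j)
  have hposted := fun i => mul_measure_Ici_le_toENNReal_Rev₁ (F i)
  calc ∫⁻ x, ENNReal.ofReal (M.s x) ∂Measure.pi F
      ≤ ∫⁻ x, (∑ i, ENNReal.ofReal (M.slicePayment i x) +
          ∑ j, (matchedSet j).indicator (fun x => (x j : ℝ≥0∞)) x) ∂Measure.pi F :=
        lintegral_mono hIR.ofReal_payment_le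
    _ = ∑ i, ∫⁻ x, ENNReal.ofReal (M.slicePayment i x) ∂Measure.pi F +
          ∑ j, ∫⁻ x in matchedSet j, x j ∂Measure.pi F := by
        rw [lintegral_add_left (Finset.measurable_fun_sum _ fun i _ => hslice i),
          lintegral_finsetSum _ fun i _ => hslice i, lintegral_finsetSum _ fun j _ => hmatched j]
        simp only [lintegral_indicator (measurableSet_matchedSet _)]
    _ ≤ ∑ i, (Rev₁ (F i)).toENNReal +
          (1 + ENNReal.ofReal (Real.log (Fintype.card ι))) * ∑ i, (Rev₁ (F i)).toENNReal :=
        add_le_add (Finset.sum_le_sum fun i _ => hIC.lintegral_pi_slicePayment_le F i) <|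
          (Finset.sum_le_sum fun j _ => setLIntegral_matchedSet_le F hposted j).trans <|
            sum_lintegral_min_sum_le hposted
    _ = ENNReal.ofReal (2 + Real.log (Fintype.card ι)) * ∑ i, (Rev₁ (F i)).toENNReal := by
        rw [ENNReal.ofReal_add zero_le_two (Real.log_natCast_nonneg _), ENNReal.ofReal_ofNat]
        ring

end Mechanism

theorem coe_sum_toENNReal {ι : Type*} {s : Finset ι} {f : ι → EReal} (hf : ∀ i ∈ s, 0 ≤ f i) :
    ((∑ i ∈ s, (f i).toENNReal : ℝ≥0∞) : EReal) = ∑ i ∈ s, f i := by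
  induction s using Finset.cons_induction with
  | empty => simp
  | cons i s his ih =>
    rw [Finset.forall_mem_cons] at hf
    rw [Finset.sum_cons, Finset.sum_cons, EReal.coe_ennreal_add, EReal.coe_toENNReal hf.1, ih hf.2]

theorem theorem3_general {ι : Type*} [Fintype ι] [Nonempty ι] (F : ι → Measure ℝ≥0)
    [∀ i, IsProbabilityMeasure (F i)] :
    Rev (Measure.pi F) ≤ ((2 + Real.log (Fintype.card ι) : ℝ) : EReal) * ∑ i, Rev₁ (F i) := by
  refine iSup_le fun M => iSup₂_le fun hIC hIR => (M.revenue_le_lintegral _).trans ?_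
  have hlog : 0 ≤ 2 + Real.log (Fintype.card ι) :=
    add_nonneg zero_le_two (Real.log_natCast_nonneg _)
  have h := EReal.coe_ennreal_le_coe_ennreal_iff.mpr (Mechanism.lintegral_payment_le hIC hIR F)
  rwa [EReal.coe_ennreal_mul, EReal.coe_ennreal_ofReal, max_eq_left hlog,
    coe_sum_toENNReal fun i _ => Rev₁_nonneg (F i)] at h

theorem two_add_log_le_six_mul_log_sq {x : ℝ} (hx : 2 ≤ x) :
    2 + Real.log x ≤ 6 * Real.log x ^ 2 := by
  have hlog : Real.log 2 ≤ Real.log x := Real.log_le_log two_pos hx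
  nlinarith [Real.log_two_gt_d9]

theorem div_log_sq_mul_le {x : ℝ} (hx : 2 ≤ x) {R S : EReal} (hS : 0 ≤ S)
    (h : R ≤ ((2 + Real.log x : ℝ) : EReal) * S) :
    ((1 / 6 / Real.log x ^ 2 : ℝ) : EReal) * R ≤ S := by
  have hlog : 0 < Real.log x := Real.log_pos (one_lt_two.trans_le hx)
  have hcoeff : 1 / 6 / Real.log x ^ 2 * (2 + Real.log x) ≤ 1 := by
    rw [div_div, one_div_mul_eq_div, div_le_one (by positivity)]
    exact two_add_log_le_six_mul_log_sq hx
  calc ((1 / 6 / Real.log x ^ 2 : ℝ) : EReal) * R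
      ≤ ((1 / 6 / Real.log x ^ 2 : ℝ) : EReal) * (((2 + Real.log x : ℝ) : EReal) * S) :=
        mul_le_mul_of_nonneg_left h (EReal.coe_nonneg.mpr (by positivity))
    _ = ((1 / 6 / Real.log x ^ 2 * (2 + Real.log x) : ℝ) : EReal) * S := by
        rw [EReal.coe_mul, mul_assoc]
    _ ≤ 1 * S := mul_le_mul_of_nonneg_right (by exact_mod_cast hcoeff) hS
    _ = S := one_mul S

theorem theorem3 :
    ∃ c : ℝ, 0 < c ∧
      ∀ (k : ℕ), 2 ≤ k →
        ∀ (F : Fin k → Measure ℝ≥0), (∀ i, IsProbabilityMeasure (F i)) →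
          ((c / Real.log (k : ℝ) ^ 2 : ℝ) : EReal) * Rev (Measure.pi F) ≤ ∑ i, Rev₁ (F i) := by
  refine ⟨1 / 6, by norm_num, fun k hk F _ => ?_⟩
  have : NeZero k := ⟨by omega⟩
  exact div_log_sq_mul_le (by exact_mod_cast hk)
    (Finset.sum_nonneg fun i _ => Rev₁_nonneg (F i)) (by simpa using theorem3_general F)
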